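/- Let $S_n$ be the set of permutations of $\{1,\dots,n\}$, where $\sigma\in S_n$ is viewed as a deck of cards laid out in a row, $\sigma_j$ being the number of the card in the $j$-th position from the left. The card-cyclic to random insertion shuffle removes and reinserts each of the $n$ cards exactly once, one after another, in the original left to right order of the cards, each card being reinserted in a position that is uniformly distributed on $\{1,\dots,n\}$, independently of the other reinsertions. Let $p_n(\mathrm{id},\cdot)$ be the distribution of the deck after one such shuffle started from the deck $1,2,\dots,n$, let $U_n$ be the uniform distribution on $S_n$, and let $\|\mu-\nu\|_{TV}=\sup_{A\subset S_n}(\mu(A)-\nu(A))$. For real $M,L>0$ let $$A^{(n)}_{M,L}=\{\sigma\in S_n:\ \sigma_j\le M n^{1/2}\ \text{for some } j\le L\}.$$ Then for all sufficiently large $C$, $$\lim_{M\to\infty}\lim_{n\to\infty}p_n(\mathrm{id},A^{(n)}_{M,CM^2})=1$$ (the inner limit existing for every real $M>0$). In particular, $$\lim_{n\to\infty}\|p_n(\mathrm{id},\cdot)-U_n\|_{TV}=1.$$ -/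

import Mathlib

/-- Remove the card `c` from the deck `d` and reinsert it so that it occupies
position `j`, where positions are counted from `0` from the left. -/
def moveCard {n : ℕ} (d : List (Fin n)) (c : Fin n) (j : ℕ) : List (Fin n) :=
  (d.erase c).insertIdx j c

/-- The deck (listed from left to right) after one shuffle of the deck `σ 0, σ 1, …, σ (n - 1)`:
the cards are removed and reinserted once each, in their original left to right order,
the card `c` being reinserted in position `w c`. -/
def shuffledDeck {n : ℕ} (σ : Equiv.Perm (Fin n)) (w : Fin n → Fin n) : List (Fin n) :=
  (List.ofFn σ).foldl (fun d c => moveCard d c (w c)) (List.ofFn σ)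

theorem moveCard_perm {n : ℕ} {d : List (Fin n)} (hd : d.Perm (List.finRange n)) (c j : Fin n) :
    (moveCard d c j).Perm (List.finRange n) := by
  have hc : c ∈ d := hd.mem_iff.2 (List.mem_finRange c)
  have hl : d.length = n := by simpa using hd.length_eq
  have hj : (j : ℕ) ≤ (d.erase c).length := by
    rw [List.length_erase_of_mem hc, hl]
    have := j.isLt
    omega
  exact ((List.perm_insertIdx c _ hj).trans (List.perm_cons_erase hc).symm).trans hd

theorem ofFn_perm_finRange {n : ℕ} (σ : Equiv.Perm (Fin n)) :
    (List.ofFn σ).Perm (List.finRange n) := by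
  rw [List.perm_ext_iff_of_nodup (List.nodup_ofFn.2 σ.injective) (List.nodup_finRange n)]
  intro a
  simp [List.mem_ofFn, σ.surjective a]

theorem shuffledDeck_perm {n : ℕ} (σ : Equiv.Perm (Fin n)) (w : Fin n → Fin n) :
    (shuffledDeck σ w).Perm (List.finRange n) := by
  unfold shuffledDeck
  have key : ∀ (l d : List (Fin n)), d.Perm (List.finRange n) →
      (l.foldl (fun d c => moveCard d c (w c)) d).Perm (List.finRange n) := by
    intro l
    induction l with
    | nil => exact fun d hd => hd
    | cons c l ih => exact fun d hd => ih _ (moveCard_perm hd c (w c))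
  exact key _ _ (ofFn_perm_finRange σ)

theorem shuffledDeck_length {n : ℕ} (σ : Equiv.Perm (Fin n)) (w : Fin n → Fin n) :
    (shuffledDeck σ w).length = n := by
  simpa using (shuffledDeck_perm σ w).length_eq

/-- The arrangement reached from `σ` by one shuffle with reinsertion positions `w`. As for every
arrangement, its value at `j` is the card in position `j` from the left. -/
noncomputable def shuffle {n : ℕ} (σ : Equiv.Perm (Fin n)) (w : Fin n → Fin n) :
    Equiv.Perm (Fin n) :=
  Equiv.ofBijective
    (fun j : Fin n => (shuffledDeck σ w).get (j.cast (shuffledDeck_length σ w).symm))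
    (Finite.injective_iff_bijective.1 (by
      have hn : (shuffledDeck σ w).Nodup :=
        (shuffledDeck_perm σ w).nodup_iff.2 (List.nodup_finRange n)
      exact (List.nodup_iff_injective_get.1 hn).comp (Fin.cast_injective _)))

instance instNonemptyInsertionPositions (n : ℕ) : Nonempty (Fin n → Fin n) := ⟨id⟩

/-- The law `p_n(σ, ·)` of the deck after one card-cyclic to random insertion shuffle started
from `σ`: the reinsertion positions of the `n` cards are independent and uniform. -/
noncomputable def shuffleLaw (n : ℕ) (σ : Equiv.Perm (Fin n)) : PMF (Equiv.Perm (Fin n)) :=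
  (PMF.uniformOfFintype (Fin n → Fin n)).map (shuffle σ)

/-- The uniform law `U_n` on the symmetric group. -/
noncomputable def uniformLaw (n : ℕ) : PMF (Equiv.Perm (Fin n)) :=
  PMF.uniformOfFintype (Equiv.Perm (Fin n))

/-- The probability of the event `A` under the law `μ`, as a real number. -/
noncomputable def eventProb {α : Type*} (μ : PMF α) (A : Set α) : ℝ :=
  (μ.toOuterMeasure A).toReal

/-- The total variation distance `sup_A (μ(A) - ν(A))`. -/
noncomputable def totalVariation {α : Type*} (μ ν : PMF α) : ℝ :=
  ⨆ A : Set α, (eventProb μ A - eventProb ν A)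

/-- The event that a card with number at most `M √n` is in one of the first `L` positions.
The card `i : Fin n` has number `i + 1`, and `j : Fin n` is the `(j + 1)`-st position. -/
def smallCardInFront (n : ℕ) (M L : ℝ) : Set (Equiv.Perm (Fin n)) :=
  {σ | ∃ j : Fin n, ((j : ℕ) : ℝ) + 1 ≤ L ∧ ((σ j : ℕ) : ℝ) + 1 ≤ M * Real.sqrt n}

/-! Put m = ⌊M√n⌋ and call the cards below m small. While these are reinserted, the number R of
unmoved cards in front of all moved ones is itself a walk, R ↦ min(R - 1, w). After m steps it is
positive with probability ∏_{i<m} (1 - (1+i)/n) → exp(-M²/2), so for large M a small card is then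
most likely on top.

From there on the leftmost small card is pushed back only by cards inserted in front of it. With V
moved and no unmoved cards ahead, V grows by one with probability (V+1)/n. Hence the mean of V + 1
stays below (1+1/n)^n ≤ e, and Markov's inequality bounds the probability of falling out of the
first ℓ positions by e/ℓ (`leaderProb_lower_bound`). This gives the lower bound (1 - e/ℓ)(1 -
exp(-M²/2)) with ℓ = ⌊CM²⌋ (`le_of_tendsto_eventProb`), which tends to 1. Under the uniform law the
same event has probability at most ℓm/n → 0, whence the total variation limit.

That the inner limit exists needs the whole law of R: an atom at 0 and, at R = x√n, a limiting
density M exp(-(Mx + M²/2)). Removing x√n unmoved cards from the front brings a Poisson number of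
arrivals of mean x²/2; then a linear birth process runs for unit time. Both are limits of products
of near-identity operators (`tendsto_stepProd`, `tendsto_leaderProb`), and `tendsto_sum_leaderProb`
integrates over x. -/

/-! ### Random walks driven by uniform letters -/

/-- The mean of `G` after `N` steps of the walk that moves from `s` to `step s a`, where the
letters `a < n` are independent and uniform. -/
noncomputable def walkMean {S : Type*} (n : ℕ) (step : S → ℕ → S) (G : S → ℝ) : ℕ → S → ℝ
  | 0, s => G s
  | N + 1, s => (∑ a ∈ Finset.range n, walkMean n step G N (step s a)) / n

theorem walkMean_add {S : Type*} (n : ℕ) (step : S → ℕ → S) (G : S → ℝ) (a b : ℕ) (s : S) :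
    walkMean n step G (a + b) s = walkMean n step (walkMean n step G b) a s := by
  induction a generalizing s with
  | zero => simp [walkMean]
  | succ a ih => simp only [Nat.succ_add, walkMean, ih]

theorem walkMean_eq_sum {S : Type*} (n : ℕ) (step : S → ℕ → S) (G : S → ℝ) (N : ℕ) (s : S) :
    walkMean n step G N s =
      (∑ w : Fin N → Fin n, G ((List.ofFn fun i => (w i : ℕ)).foldl step s)) / (n : ℝ) ^ N := by
  induction N generalizing s with
  | zero => simp [walkMean]
  | succ N ih =>
    rw [walkMean, ← (Fin.consEquiv fun _ : Fin (N + 1) => Fin n).sum_comp, Fintype.sum_prod_type,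
      Finset.sum_range, pow_succ, ← div_div, Finset.sum_div _ _ ((n : ℝ) ^ N)]
    congr 1
    refine Finset.sum_congr rfl fun a _ => ?_
    rw [ih]
    simp [Fin.consEquiv, List.ofFn_succ]

/-- Two walks that can be coupled have the same means. -/
theorem walkMean_congr {S S' : Type*} {n : ℕ} {step : S → ℕ → S} {step' : S' → ℕ → S'}
    {G : S → ℝ} {G' : S' → ℝ} (Rel : ℕ → S → S' → Prop)
    (hstep : ∀ k s s' a, a < n → Rel k s s' → Rel (k + 1) (step s a) (step' s' a)) (N : ℕ)
    (k : ℕ) (hG : ∀ s s', Rel (k + N) s s' → G s = G' s') (s : S) (s' : S') (h : Rel k s s') :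
    walkMean n step G N s = walkMean n step' G' N s' := by
  induction N generalizing k s s' with
  | zero => exact hG s s' h
  | succ N ih =>
    simp only [walkMean]
    congr 1
    refine Finset.sum_congr rfl fun a ha => ih (k + 1) (fun t t' ht => hG t t' ?_) _ _
      (hstep k s s' a (Finset.mem_range.1 ha) h)
    rwa [Nat.succ_add_eq_add_succ] at ht

theorem walkMean_mono {S : Type*} {n : ℕ} {step : S → ℕ → S} {G G' : S → ℝ}
    (h : ∀ s, G s ≤ G' s) (N : ℕ) (s : S) : walkMean n step G N s ≤ walkMean n step G' N s := by
  induction N generalizing s with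
  | zero => exact h s
  | succ N ih =>
    simp only [walkMean]
    gcongr
    exact ih _

theorem walkMean_const {S : Type*} {n : ℕ} (hn : n ≠ 0) (step : S → ℕ → S) (c : ℝ) (N : ℕ)
    (s : S) : walkMean n step (fun _ => c) N s = c := by
  induction N generalizing s with
  | zero => rfl
  | succ N ih => simp [walkMean, ih, hn]

theorem walkMean_linear {S ι : Type*} (n : ℕ) (step : S → ℕ → S) (I : Finset ι)
    (c : ι → ℝ) (G : ι → S → ℝ) (N : ℕ) (s : S) :
    walkMean n step (fun s => ∑ i ∈ I, c i * G i s) N s =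
      ∑ i ∈ I, c i * walkMean n step (G i) N s := by
  induction N generalizing s with
  | zero => rfl
  | succ N ih =>
    simp only [walkMean, ih, mul_div_assoc', Finset.mul_sum, ← Finset.sum_div]
    rw [Finset.sum_comm]

/-! ### The deck as a list of natural numbers -/

/-- One reinsertion: the state `(t, d)` means that the cards `0, …, t - 1` have been reinserted
and that the deck is `d`. -/
def deckStep (s : ℕ × List ℕ) (w : ℕ) : ℕ × List ℕ :=
  (s.1 + 1, (s.2.erase s.1).insertIdx w s.1)

theorem map_foldl_moveCard {n : ℕ} (w : Fin n → Fin n) (l d : List (Fin n)) (t k : ℕ)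
    (h : l.map Fin.val = List.range' t k) :
    (l.foldl (fun d c => moveCard d c (w c)) d).map Fin.val =
      ((l.map fun c => (w c : ℕ)).foldl deckStep (t, d.map Fin.val)).2 := by
  induction l generalizing d t k with
  | nil => rfl
  | cons c l ih =>
    cases k with
    | zero => simp at h
    | succ k =>
      rw [List.range'_succ, List.map_cons, List.cons.injEq] at h
      rw [List.foldl_cons, ih _ (t + 1) k h.2, List.map_cons, List.foldl_cons]
      simp only [deckStep, moveCard, List.map_insertIdx, List.map_erase Fin.val_injective, h.1]

theorem map_shuffledDeck_one {n : ℕ} (w : Fin n → Fin n) :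
    (shuffledDeck 1 w).map Fin.val =
      ((List.ofFn fun i => (w i : ℕ)).foldl deckStep (0, List.range n)).2 := by
  have h : List.ofFn (1 : Equiv.Perm (Fin n)) = List.finRange n := by
    rw [List.finRange]; rfl
  have h2 : (List.finRange n).map Fin.val = List.range n := by simp
  rw [shuffledDeck, h, map_foldl_moveCard w _ _ 0 n (by rw [h2, List.range_eq_range']), h2]
  congr 2
  rw [List.ofFn_eq_map]

theorem List.insertIdx_append_of_le {α : Type*} (l₁ l₂ : List α) {i : ℕ} (h : i ≤ l₁.length)
    (a : α) : (l₁ ++ l₂).insertIdx i a = l₁.insertIdx i a ++ l₂ := by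
  induction l₁ generalizing i with
  | nil => obtain rfl : i = 0 := by simpa using h
           simp
  | cons b l₁ ih =>
    cases i with
    | zero => simp
    | succ i => simp [ih (by simpa using h)]

theorem List.insertIdx_append_length_add {α : Type*} (l₁ l₂ : List α) (i : ℕ) (a : α) :
    (l₁ ++ l₂).insertIdx (l₁.length + i) a = l₁ ++ l₂.insertIdx i a := by
  induction l₁ with
  | nil => simp
  | cons b l₁ ih => simp [Nat.succ_add, ih]

theorem List.insertIdx_eq_take_append {α : Type*} (l : List α) {i : ℕ} (h : i ≤ l.length) (a : α) :
    l.insertIdx i a = l.take i ++ a :: l.drop i := by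
  induction l generalizing i with
  | nil => obtain rfl : i = 0 := by simpa using h
           simp
  | cons b l ih =>
    cases i with
    | zero => simp
    | succ i => simp [ih (by simpa using h)]

/-! ### The number of unmoved cards in front of all moved cards -/

/-- The number of unmoved cards in front of the leftmost moved card, after one more
reinsertion. -/
def frontStep (R w : ℕ) : ℕ := min (R - 1) w

/-- After `k` reinsertions, the deck begins with exactly `R` unmoved cards. -/
def FrontRel (n k : ℕ) (s : ℕ × List ℕ) (R : ℕ) : Prop :=
  s.1 = k ∧ R ≤ n - k ∧ ∃ rest, s.2 = List.range' k R ++ rest ∧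
    ((k = 0 ∧ R = n ∧ rest = []) ∨ ∃ c B, rest = c :: B ∧ c < k)

/-- The next card to move heads the run of unmoved cards, if there is one. Taking it out shortens
the run by one, and putting it back inside the run cuts the run at `w`. -/
theorem FrontRel.step {n : ℕ} (k : ℕ) (s : ℕ × List ℕ) (R w : ℕ) (hw : w < n)
    (h : FrontRel n k s R) : FrontRel n (k + 1) (deckStep s w) (frontStep R w) := by
  obtain ⟨t, d⟩ := s
  obtain ⟨rfl, hle, rest, hd, hrest⟩ := h
  simp only at hd hle hrest ⊢
  simp only [deckStep, frontStep, FrontRel, true_and]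
  rcases Nat.eq_zero_or_pos R with rfl | hR
  -- The untouched deck would have `n = 0`, contradicting `w < n`.
  · obtain ⟨-, rfl, -⟩ | ⟨c, B, rfl, hc⟩ := hrest
    · omega
    have hd' : d.erase t = c :: B.erase t := by
      rw [hd]; simp [hc.ne]
    rw [hd']
    cases w with
    | zero => exact ⟨by omega, t :: c :: B.erase t, by simp, Or.inr ⟨_, _, rfl, by omega⟩⟩
    | succ w => exact ⟨by omega, c :: (B.erase t).insertIdx w t, by simp,
        Or.inr ⟨_, _, rfl, by omega⟩⟩
  · obtain _ | R := R
    · omega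
    have hle' : R ≤ n - (t + 1) := by clear hrest hd; omega
    have hd' : d.erase t = List.range' (t + 1) R ++ rest := by
      rw [hd, List.range'_succ]; simp
    rw [hd']
    refine ⟨(min_le_left _ _).trans hle', ?_⟩
    by_cases hwR : w ≤ R
    · have htake : (List.range' (t + 1) R).take w = List.range' (t + 1) w := by
        rw [← Nat.add_sub_cancel' hwR, ← List.range'_append_1]
        exact List.take_left' (by simp)
      rw [List.insertIdx_append_of_le _ _ (by simpa using hwR),
        List.insertIdx_eq_take_append _ (by simpa using hwR), List.append_assoc,
        htake, Nat.add_sub_cancel, min_eq_right hwR]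
      exact ⟨_, rfl, Or.inr ⟨_, _, rfl, by omega⟩⟩
    -- In the untouched deck the run is everything, so `w < n` forces `w ≤ R`. Otherwise position
    -- `R` holds the moved card `c`, and inserting strictly behind it keeps it in place.
    · obtain ⟨-, h1, -⟩ | ⟨c, B, rfl, hc⟩ := hrest
      · omega
      obtain ⟨v, rfl⟩ : ∃ v, w = R + (v + 1) := ⟨w - R - 1, by omega⟩
      have := List.insertIdx_append_length_add (List.range' (t + 1) R) (c :: B) (v + 1) t
      rw [List.length_range'] at this
      rw [this, Nat.add_sub_cancel, min_eq_left (by omega)]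
      exact ⟨_, rfl, Or.inr ⟨c, B.insertIdx v t, by simp, by omega⟩⟩

theorem FrontRel.init (n : ℕ) : FrontRel n 0 (0, List.range n) n :=
  ⟨rfl, by simp, [], by simp [List.range_eq_range'], Or.inl ⟨rfl, rfl, rfl⟩⟩

/-! ### The cards in front of the leftmost small card -/

/-- In the state `(R, V)` there are `R` unmoved and `V` moved cards in front of the leftmost
small card. -/
def leaderStep (s : ℕ × ℕ) (w : ℕ) : ℕ × ℕ :=
  (s.1 - 1, if w ≤ s.2 + (s.1 - 1) then s.2 + 1 else s.2)

/-- After `k` further reinsertions, there are `R` unmoved and `V` moved cards in front of the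
leftmost card with number less than `m`. -/
def LeaderRel (m k : ℕ) (s : ℕ × List ℕ) (q : ℕ × ℕ) : Prop :=
  s.1 = m + k ∧ ∃ A c B, s.2 = A ++ c :: B ∧ c < m ∧ (∀ x ∈ A, m ≤ x) ∧
    A.length = q.2 + q.1 ∧ A.filter (fun x => s.1 ≤ x) = List.range' s.1 q.1

/-- Small cards are not touched any more, so the same card `c` stays leftmost among them. The
unmoved cards ahead of it are the next ones in order, so the card `t` is ahead exactly when `R > 0`;
truncated subtraction covers `R = 0`. -/
theorem LeaderRel.step {m : ℕ} (k : ℕ) (s : ℕ × List ℕ) (q : ℕ × ℕ) (w : ℕ)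
    (h : LeaderRel m k s q) : LeaderRel m (k + 1) (deckStep s w) (leaderStep q w) := by
  obtain ⟨t, d⟩ := s
  obtain ⟨R, V⟩ := q
  obtain ⟨ht, A, c, B, hd, hc, hA, hlen, hfil⟩ := h
  simp only at ht hd hlen hfil
  have hfil' : ∀ A' : List ℕ, A'.filter (fun x => decide (t ≤ x)) = List.range' t R →
      (A'.erase t).filter (fun x => decide (t + 1 ≤ x)) = List.range' (t + 1) (R - 1) := by
    intro A' h
    have h1 : A'.filter (fun x => decide (t + 1 ≤ x)) = List.range' (t + 1) (R - 1) := by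
      have h2 := congrArg (List.filter fun x => decide (t + 1 ≤ x)) h
      rw [List.filter_filter] at h2
      have h3 : A'.filter (fun x => decide (t + 1 ≤ x)) =
          A'.filter (fun x => decide (t + 1 ≤ x) && decide (t ≤ x)) := by
        congr 1; ext x
        simp only [← Bool.decide_and, decide_eq_decide]
        omega
      rw [h3, h2]
      cases R with
      | zero => simp
      | succ R =>
        rw [List.range'_succ, List.filter_cons_of_neg (by simp)]
        exact List.filter_eq_self.2 fun x hx => by simp at hx ⊢; omega
    rw [← List.erase_filter, h1]
    exact List.erase_of_not_mem fun hx => by simp at hx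
  have key : ∃ A' B', d.erase t = A' ++ c :: B' ∧ (∀ x ∈ A', m ≤ x) ∧
      A'.length = V + (R - 1) ∧
      A'.filter (fun x => decide (t + 1 ≤ x)) = List.range' (t + 1) (R - 1) := by
    have hmem : t ∈ A ↔ 0 < R := by
      have : t ∈ A ↔ t ∈ A.filter (fun x => decide (t ≤ x)) := by simp
      rw [this, hfil]; simp
    by_cases hR : 0 < R
    · refine ⟨A.erase t, B, ?_, fun x hx => hA x (List.mem_of_mem_erase hx), ?_, hfil' A hfil⟩
      · rw [hd, List.erase_append_left _ (hmem.2 hR)]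
      · rw [List.length_erase_of_mem (hmem.2 hR)]; omega
    · have hnot : t ∉ A := fun h => hR (hmem.1 h)
      refine ⟨A, B.erase t, ?_, hA, by omega, ?_⟩
      · rw [hd, List.erase_append_right _ hnot]
        simp [show c ≠ t by omega]
      · have := hfil' A hfil
        rwa [List.erase_of_not_mem hnot] at this
  obtain ⟨A', B', hd', hA', hlen', hfilA⟩ := key
  refine ⟨by simp only [deckStep]; omega, ?_⟩
  simp only [deckStep, leaderStep, hd']
  by_cases hw : w ≤ V + (R - 1)
  · have hwl : w ≤ A'.length := by omega
    refine ⟨A'.insertIdx w t, c, B', List.insertIdx_append_of_le _ _ hwl _, hc, ?_, ?_, ?_⟩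
    · intro x hx
      rcases List.eq_or_mem_of_mem_insertIdx hx with rfl | hx
      · omega
      · exact hA' x hx
    · rw [List.length_insertIdx_of_le_length hwl, if_pos hw]; omega
    · rw [List.insertIdx_eq_take_append _ hwl, List.filter_append,
        List.filter_cons_of_neg (by simp), ← List.filter_append, List.take_append_drop, hfilA]
  · obtain ⟨v, rfl⟩ : ∃ v, w = A'.length + (v + 1) := ⟨w - A'.length - 1, by omega⟩
    refine ⟨A', c, B'.insertIdx v t, ?_, hc, hA', ?_, hfilA⟩
    · rw [List.insertIdx_append_length_add]; simp
    · rw [if_neg hw]; exact hlen'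

/-- The probability that, after `N` reinsertions from the state `(R, V)`, the leftmost small card
is in one of the first `ℓ` positions. -/
noncomputable def leaderProb (n ℓ N R V : ℕ) : ℝ :=
  walkMean n leaderStep (fun q => if q.2 + q.1 < ℓ then 1 else 0) N (R, V)

/-- The deck has a card with number less than `m` in one of the first `ℓ` positions. -/
def HasSmallInFront (m ℓ : ℕ) (d : List ℕ) : Prop := ∃ j < ℓ, ∃ c < m, d[j]? = some c

theorem hasSmallInFront_iff {m ℓ : ℕ} {A B : List ℕ} {c : ℕ} (hc : c < m) (hA : ∀ x ∈ A, m ≤ x) :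
    HasSmallInFront m ℓ (A ++ c :: B) ↔ A.length < ℓ := by
  constructor
  · rintro ⟨j, hj, x, hx, h⟩
    by_contra hcon
    rw [List.getElem?_append_left (by omega)] at h
    exact absurd (hA x (List.mem_of_getElem? h)) (by omega)
  · exact fun h => ⟨A.length, h, c, hc, by simp⟩

-- The two walks meet at time `m`: every small card has then been moved and nothing else has, so the
-- first card after the `R` unmoved ones is the leftmost small card and `V = 0`.
open Classical in
theorem walkMean_deckStep {n m ℓ : ℕ} (hm : 1 ≤ m) (hmn : m ≤ n) :
    walkMean n deckStep (fun s => if HasSmallInFront m ℓ s.2 then 1 else 0) n (0, List.range n) =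
      walkMean n frontStep (fun R => leaderProb n ℓ (n - m) R 0) m n := by
  have : walkMean n deckStep (fun s => if HasSmallInFront m ℓ s.2 then (1 : ℝ) else 0) n
      (0, List.range n) = walkMean n deckStep (fun s => if HasSmallInFront m ℓ s.2 then 1 else 0)
      (m + (n - m)) (0, List.range n) := by rw [Nat.add_sub_cancel' hmn]
  rw [this, walkMean_add]
  refine walkMean_congr (FrontRel n) (fun k s R a ha => FrontRel.step k s R a ha) m 0 ?_ _ _
    (FrontRel.init n)
  rintro ⟨t, d⟩ R ⟨ht, hle, rest, hd, hrest⟩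
  simp only at ht hd
  rw [zero_add] at *
  subst ht
  obtain ⟨h, -⟩ | ⟨c, B, rfl, hc⟩ := hrest
  · omega
  refine walkMean_congr (LeaderRel t) (fun k s q a _ => LeaderRel.step k s q a) _ 0 ?_ _ _ ?_
  · rintro ⟨t', d'⟩ ⟨R', V'⟩ ⟨-, A, c', B', rfl, hc', hA, hlen, -⟩
    simp only [hasSmallInFront_iff hc' hA, hlen]
  · refine ⟨rfl, _, c, B, hd, hc, fun x hx => by simp at hx; omega, by simp, ?_⟩
    exact List.filter_eq_self.2 fun x hx => by simp at hx ⊢; omega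

/-! ### The shuffle law as the mean of a walk -/

open Classical in
theorem eventProb_shuffleLaw_one {n : ℕ} (A : Set (Equiv.Perm (Fin n))) :
    eventProb (shuffleLaw n 1) A =
      (∑ w : Fin n → Fin n, if shuffle 1 w ∈ A then (1 : ℝ) else 0) / (n : ℝ) ^ n := by
  rw [eventProb, shuffleLaw, PMF.toOuterMeasure_map_apply,
    PMF.toOuterMeasure_uniformOfFintype_apply]
  simp [Fintype.card_subtype]

theorem hasSmallInFront_shuffledDeck_iff {n m ℓ : ℕ} (w : Fin n → Fin n) :
    HasSmallInFront m ℓ ((shuffledDeck 1 w).map Fin.val) ↔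
      ∃ j : Fin n, (j : ℕ) < ℓ ∧ (shuffle 1 w j : ℕ) < m := by
  have hl := shuffledDeck_length 1 w
  constructor
  · rintro ⟨j, hj, c, hc, h⟩
    rw [List.getElem?_map, Option.map_eq_some_iff] at h
    obtain ⟨x, hx, rfl⟩ := h
    obtain ⟨hj', rfl⟩ := List.getElem?_eq_some_iff.1 hx
    exact ⟨⟨j, by omega⟩, hj, hc⟩
  · rintro ⟨j, hj, h⟩
    refine ⟨j, hj, _, h, ?_⟩
    rw [List.getElem?_map, List.getElem?_eq_getElem (by omega)]
    rfl

theorem eventProb_shuffleLaw_eq_walkMean {n m ℓ : ℕ} (hm : 1 ≤ m) (hmn : m ≤ n) :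
    eventProb (shuffleLaw n 1) {σ | ∃ j : Fin n, (j : ℕ) < ℓ ∧ (σ j : ℕ) < m} =
      walkMean n frontStep (fun R => leaderProb n ℓ (n - m) R 0) m n := by
  classical
  rw [← walkMean_deckStep hm hmn, walkMean_eq_sum, eventProb_shuffleLaw_one]
  congr 1
  refine Finset.sum_congr rfl fun w _ => ?_
  rw [← map_shuffledDeck_one]
  have hiff := hasSmallInFront_shuffledDeck_iff (m := m) (ℓ := ℓ) w
  split_ifs with h1 h2 h2
  · rfl
  · exact absurd (hiff.2 h1) h2
  · exact absurd (hiff.1 h2) h1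
  · rfl

/-! ### The law of the number of unmoved cards in front -/

theorem sum_range_indicator_le (n k : ℕ) (h : k ≤ n) (c : ℝ) :
    ∑ a ∈ Finset.range n, (if k ≤ a then c else 0) = (n - k) * c := by
  rw [← Finset.sum_filter, Finset.sum_const, nsmul_eq_mul]
  have : (Finset.range n).filter (fun a => k ≤ a) = Finset.Ico k n := by
    ext a; simp; omega
  rw [this, Nat.card_Ico, Nat.cast_sub h]

/-- The probability that at least `r ≥ 1` unmoved cards are in front of the moved ones. -/
theorem walkMean_frontStep_indicator {n r : ℕ} (hn : n ≠ 0) (hr : 1 ≤ r) (k R : ℕ)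
    (hk : r + k ≤ n + 1) :
    walkMean n frontStep (fun R => if r ≤ R then 1 else 0) k R =
      if r + k ≤ R then ∏ i ∈ Finset.range k, (1 - ((r : ℝ) + i) / n) else 0 := by
  induction k generalizing R with
  | zero => simp [walkMean]
  | succ k ih =>
    have hn' : (n : ℝ) ≠ 0 := by exact_mod_cast hn
    simp only [walkMean, ih _ (by omega : r + k ≤ n + 1)]
    by_cases h : r + (k + 1) ≤ R
    · rw [if_pos h, Finset.prod_range_succ]
      -- Each of the `k` remaining steps loses at least one card, so the first letter must leave `r
      -- + k` cards.
      have h1 : ∀ a, r + k ≤ frontStep R a ↔ r + k ≤ a := fun a => by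
        simp only [frontStep, le_min_iff]; omega
      simp only [h1]
      rw [sum_range_indicator_le _ _ (by omega)]
      push_cast
      field_simp
    · rw [if_neg h]
      have h1 : ∀ a, ¬ r + k ≤ frontStep R a := fun a => by
        simp only [frontStep, le_min_iff]; omega
      simp [h1]

/-- The probability that at least `r` unmoved cards are in front of the first `m` cards after
these have been reinserted. -/
noncomputable def frontTail (n m r : ℕ) : ℝ := ∏ i ∈ Finset.range m, (1 - ((r : ℝ) + i) / n)

/-- The law of the number of unmoved cards in front of the first `m` cards after these have been
reinserted. -/
noncomputable def frontMass (n m r : ℕ) : ℝ :=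
  m / n * ∏ i ∈ Finset.range (m - 1), (1 - ((r : ℝ) + 1 + i) / n)

/-- The two products share `m - 1` factors; the remaining ones, `1 - r/n` and `1 - (r+m)/n`, differ
by `m/n`. -/
theorem frontTail_sub {n m r : ℕ} (hm : 1 ≤ m) :
    frontTail n m r - frontTail n m (r + 1) = frontMass n m r := by
  obtain ⟨m, rfl⟩ : ∃ k, m = k + 1 := ⟨m - 1, by omega⟩
  rw [frontTail, frontTail, frontMass, Finset.prod_range_succ', Finset.prod_range_succ,
    Nat.add_sub_cancel]
  have : ∀ i : ℕ, (1 - ((r : ℝ) + ((i + 1 : ℕ) : ℝ)) / n) = 1 - ((r : ℝ) + 1 + i) / n := fun i => by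
    push_cast; ring
  simp only [this]
  push_cast
  ring

/-- Writing `G` as a combination of the indicators of `r ≤ R` reduces the mean to tail
probabilities, and Abel summation turns these into point masses. The value 0 stands apart because
truncation creates an atom there. -/
theorem walkMean_frontStep {n m : ℕ} (hm : 1 ≤ m) (hmn : m ≤ n) (G : ℕ → ℝ) :
    walkMean n frontStep G m n = G 0 * (1 - frontTail n m 1) +
      ∑ r ∈ Finset.range (n - m), G (r + 1) * frontMass n m (r + 1) := by
  have hn : n ≠ 0 := by omega
  set c : ℕ → ℝ := fun r => if r = 0 then G 0 else G r - G (r - 1) with hc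
  have hG : ∀ R ≤ n - m, G R =
      ∑ r ∈ Finset.range (n - m + 1), c r * (if r ≤ R then 1 else 0) := by
    intro R hR
    have h1 : ∀ k, ∑ r ∈ Finset.range (k + 1), c r = G k := by
      intro k
      induction k with
      | zero => simp [hc]
      | succ k ih => rw [Finset.sum_range_succ, ih]; simp [hc]
    rw [← h1 R]
    simp only [mul_ite, mul_one, mul_zero]
    rw [← Finset.sum_filter]
    refine Finset.sum_congr ?_ fun _ _ => rfl
    ext r; simp; omega
  have h2 : walkMean n frontStep G m n = walkMean n frontStep
      (fun R => ∑ r ∈ Finset.range (n - m + 1), c r * (if r ≤ R then 1 else 0)) m n := by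
    refine walkMean_congr (fun k R R' => R = R' ∧ R ≤ n - k) ?_ m 0 ?_ _ _ ⟨rfl, by omega⟩
    · rintro k R _ a ha ⟨rfl, h⟩
      refine ⟨rfl, ?_⟩
      simp only [frontStep]; omega
    · rintro R _ ⟨rfl, h⟩
      exact hG R (by omega)
  have h3 : ∀ r ∈ Finset.range (n - m), walkMean n frontStep
      (fun R => if r + 1 ≤ R then 1 else 0) m n = frontTail n m (r + 1) := by
    intro r hr
    rw [Finset.mem_range] at hr
    rw [walkMean_frontStep_indicator hn (by omega) _ _ (by omega), if_pos (by omega), frontTail]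
  -- The boundary term of the Abel summation vanishes: its last factor is `1 - n/n`.
  have hzero : frontTail n m (n - m + 1) = 0 := by
    refine Finset.prod_eq_zero (i := m - 1) (Finset.mem_range.2 (by omega)) ?_
    have : ((n - m + 1 : ℕ) : ℝ) + ((m - 1 : ℕ) : ℝ) = n := by
      rw [← Nat.cast_add]; congr 1; omega
    rw [this, div_self (by exact_mod_cast hn), sub_self]
  have abel : ∀ k, ∑ r ∈ Finset.range k, (G (r + 1) - G r) * frontTail n m (r + 1) =
      ∑ r ∈ Finset.range k, G (r + 1) * frontMass n m (r + 1) - G 0 * frontTail n m 1 +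
        G k * frontTail n m (k + 1) := by
    intro k
    induction k with
    | zero => simp
    | succ k ih =>
      rw [Finset.sum_range_succ, ih, Finset.sum_range_succ, ← frontTail_sub hm]
      ring
  rw [h2, walkMean_linear, Finset.sum_range_succ']
  have h0 : walkMean n frontStep (fun R => if 0 ≤ R then (1 : ℝ) else 0) m n = 1 := by
    simpa using walkMean_const hn frontStep 1 m n
  rw [h0, Finset.sum_congr rfl fun r hr => by rw [h3 r hr]]
  have := abel (n - m)
  simp only [hc, Nat.add_sub_cancel, if_true, Nat.succ_ne_zero, if_false] at this ⊢
  rw [this, hzero]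
  ring

theorem eventProb_shuffleLaw_eq {n m ℓ : ℕ} (hm : 1 ≤ m) (hmn : m ≤ n) :
    eventProb (shuffleLaw n 1) {σ | ∃ j : Fin n, (j : ℕ) < ℓ ∧ (σ j : ℕ) < m} =
      leaderProb n ℓ (n - m) 0 0 * (1 - frontTail n m 1) +
        ∑ r ∈ Finset.range (n - m), leaderProb n ℓ (n - m) (r + 1) 0 * frontMass n m (r + 1) := by
  rw [eventProb_shuffleLaw_eq_walkMean hm hmn, walkMean_frontStep hm hmn]

/-! ### Properties of `leaderProb` -/

theorem leaderProb_nonneg (n ℓ N R V : ℕ) : 0 ≤ leaderProb n ℓ N R V := by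
  rcases Nat.eq_zero_or_pos n with rfl | hn
  · cases N with
    | zero => simp only [leaderProb, walkMean]; positivity
    | succ N => simp [leaderProb, walkMean]
  · refine (walkMean_const hn.ne' leaderStep 0 N (R, V)).ge.trans
      (walkMean_mono (fun s => ?_) _ _)
    split_ifs <;> norm_num

theorem leaderProb_le_one {n : ℕ} (hn : n ≠ 0) (ℓ N R V : ℕ) : leaderProb n ℓ N R V ≤ 1 := by
  refine le_trans (walkMean_mono (G' := fun _ => 1) (fun s => ?_) _ _)
    (walkMean_const hn leaderStep 1 N (R, V)).le
  split_ifs <;> norm_num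

/-- `V` never decreases. This allows killing the walk at `ℓ` and working with vectors indexed by
`Fin ℓ`. -/
theorem leaderProb_eq_zero {n ℓ : ℕ} (N R V : ℕ) (h : ℓ ≤ V) : leaderProb n ℓ N R V = 0 := by
  induction N generalizing R V with
  | zero => simp only [leaderProb, walkMean]; rw [if_neg]; omega
  | succ N ih =>
    have : leaderProb n ℓ (N + 1) R V = (∑ a ∈ Finset.range n, leaderProb n ℓ N
        (leaderStep (R, V) a).1 (leaderStep (R, V) a).2) / n := rfl
    rw [this, Finset.sum_eq_zero, zero_div]
    intro a _
    refine ih _ _ ?_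
    simp only [leaderStep]
    split_ifs <;> omega

theorem leaderProb_succ {n ℓ : ℕ} (hn : n ≠ 0) (N R V : ℕ) (h : V + (R - 1) + 1 ≤ n) :
    leaderProb n ℓ (N + 1) R V = leaderProb n ℓ N (R - 1) V +
      (V + 1 + (R - 1 : ℕ)) / n *
        (leaderProb n ℓ N (R - 1) (V + 1) - leaderProb n ℓ N (R - 1) V) := by
  have hn' : (n : ℝ) ≠ 0 := by exact_mod_cast hn
  have h1 : leaderProb n ℓ (N + 1) R V = (∑ a ∈ Finset.range n, leaderProb n ℓ N
      (leaderStep (R, V) a).1 (leaderStep (R, V) a).2) / n := rfl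
  have h2 : ∀ a, leaderProb n ℓ N (leaderStep (R, V) a).1 (leaderStep (R, V) a).2 =
      leaderProb n ℓ N (R - 1) (V + 1) + (if V + (R - 1) + 1 ≤ a then
        leaderProb n ℓ N (R - 1) V - leaderProb n ℓ N (R - 1) (V + 1) else 0) := by
    intro a
    simp only [leaderStep]
    by_cases ha : a ≤ V + (R - 1)
    · rw [if_pos ha, if_neg (by omega), add_zero]
    · rw [if_neg ha, if_pos (by omega)]; ring
  rw [h1]
  simp only [h2]
  rw [Finset.sum_add_distrib, sum_range_indicator_le _ _ h, Finset.sum_const, Finset.card_range,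
    nsmul_eq_mul]
  push_cast
  field_simp
  ring

/-- Markov's inequality for `V + 1`, whose mean is multiplied by `1 + 1/n` at each step, in the form
of an induction on `N`. -/
theorem leaderProb_lower_bound {n ℓ : ℕ} (hn : n ≠ 0) (hℓ : 1 ≤ ℓ) (hℓn : ℓ ≤ n) (N V : ℕ) :
    1 - (V + 1) * (1 + 1 / (n : ℝ)) ^ N / ℓ ≤ leaderProb n ℓ N 0 V := by
  have hn' : (0 : ℝ) < n := by exact_mod_cast Nat.pos_of_ne_zero hn
  have hl' : (0 : ℝ) < ℓ := by exact_mod_cast hℓ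
  have hone : ∀ N, (1 : ℝ) ≤ (1 + 1 / (n : ℝ)) ^ N := fun N =>
    one_le_pow₀ (by have : 0 < 1 / (n : ℝ) := by positivity
                    linarith)
  -- From `ℓ` on the bound is vacuous, so the recursion is only needed where `(V+1)/n` is a
  -- probability.
  have hbig : ∀ N V : ℕ, ℓ ≤ V → 1 - (V + 1) * (1 + 1 / (n : ℝ)) ^ N / ℓ ≤ 0 := by
    intro N V h
    have h' : (ℓ : ℝ) ≤ V := by exact_mod_cast h
    rw [sub_nonpos, le_div_iff₀ hl']
    nlinarith [hone N]
  induction N generalizing V with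
  | zero =>
    by_cases h : V < ℓ
    · simp only [leaderProb, walkMean, pow_zero]
      rw [if_pos (by simpa using h)]
      have : (0 : ℝ) ≤ (V + 1) * 1 / ℓ := by positivity
      linarith
    · exact (hbig 0 V (by omega)).trans (leaderProb_nonneg _ _ _ _ _)
  | succ N ih =>
    by_cases h : V < ℓ
    · rw [leaderProb_succ hn N 0 V (by omega)]
      have hp0 : (0 : ℝ) ≤ (V + 1) / n := by positivity
      have hp1 : ((V : ℝ) + 1) / n ≤ 1 := by
        rw [div_le_one hn']; exact_mod_cast (by omega : V + 1 ≤ n)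
      have h1 := mul_le_mul_of_nonneg_left (ih (V + 1)) hp0
      have h2 := mul_le_mul_of_nonneg_left (ih V) (sub_nonneg.2 hp1)
      simp only [Nat.zero_sub, Nat.cast_zero, add_zero]
      push_cast at h1
      -- The bound solves the recursion exactly: with p = (V+1)/n, p(V+2) + (1-p)(V+1) =
      -- (V+1)(1+1/n).
      have h3 : 1 - ((V : ℝ) + 1) * (1 + 1 / (n : ℝ)) ^ (N + 1) / ℓ =
          ((V : ℝ) + 1) / n * (1 - ((V : ℝ) + 1 + 1) * (1 + 1 / (n : ℝ)) ^ N / ℓ) +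
          (1 - ((V : ℝ) + 1) / n) * (1 - ((V : ℝ) + 1) * (1 + 1 / (n : ℝ)) ^ N / ℓ) := by
        rw [pow_succ]; field_simp; ring
      rw [h3]
      linarith
    · exact (hbig _ V (by omega)).trans (leaderProb_nonneg _ _ _ _ _)

/-! ### Products of near-identity operators -/

section EulerProduct

open NormedSpace

variable {𝔸 : Type*} [NormedRing 𝔸] [NormedAlgebra ℝ 𝔸] [CompleteSpace 𝔸]

theorem norm_exp_le_exp_norm (h1 : ‖(1 : 𝔸)‖ ≤ 1) (x : 𝔸) : ‖exp x‖ ≤ Real.exp ‖x‖ := by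
  have hx := exp_series_hasSum_exp' (𝕂 := ℝ) x
  have hr := exp_series_hasSum_exp' (𝕂 := ℝ) ‖x‖
  rw [← Real.exp_eq_exp_ℝ] at hr
  refine hx.norm_le_of_bounded hr fun k => ?_
  rw [norm_smul, norm_inv, Real.norm_natCast, smul_eq_mul]
  gcongr
  rcases Nat.eq_zero_or_pos k with rfl | hk
  · simpa using h1
  · exact norm_pow_le' x hk

/-- Termwise comparison of the series from degree 2 on with the real one, then e^y - 1 ≤ y e^y used
twice. -/
theorem norm_exp_sub_one_sub_le (x : 𝔸) :
    ‖exp x - 1 - x‖ ≤ ‖x‖ ^ 2 * Real.exp ‖x‖ := by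
  have hx := (hasSum_nat_add_iff' 2).2 (exp_series_hasSum_exp' (𝕂 := ℝ) x)
  have hr := (hasSum_nat_add_iff' 2).2 (exp_series_hasSum_exp' (𝕂 := ℝ) ‖x‖)
  rw [← Real.exp_eq_exp_ℝ] at hr
  have h := hx.norm_le_of_bounded hr fun k => by
    rw [norm_smul, norm_inv, Real.norm_natCast, smul_eq_mul]
    gcongr
    exact norm_pow_le' x (by omega)
  simp only [Finset.sum_range_succ, Finset.sum_range_zero, Nat.factorial, pow_zero, pow_one,
    zero_add, Nat.cast_one, inv_one, one_smul, mul_one, ← sub_sub] at h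
  refine h.trans ?_
  have h0 := norm_nonneg x
  have h2 : Real.exp ‖x‖ - 1 ≤ ‖x‖ * Real.exp ‖x‖ := by
    have h3 := Real.one_sub_le_exp_neg ‖x‖
    have h4 := mul_le_mul_of_nonneg_right h3 (Real.exp_pos ‖x‖).le
    rw [← Real.exp_add, neg_add_cancel, Real.exp_zero] at h4
    linarith
  have h5 := mul_le_mul_of_nonneg_left h2 h0
  nlinarith

/-- The product of the factors `1 + aᵢ D + Zᵢ`, the factors of larger index being to the left. -/
noncomputable def stepProd (D : 𝔸) (a : ℕ → ℝ) (Z : ℕ → 𝔸) : ℕ → 𝔸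
  | 0 => 1
  | k + 1 => (1 + a k • D + Z k) * stepProd D a Z k

/-- Factors are replaced by exponentials one at a time. Each replacement costs at most ‖Zᵢ‖ +
aᵢ²‖D‖², up to the norms of the factors, which the exponential in front absorbs. -/
theorem norm_stepProd_sub_exp_le (h1 : ‖(1 : 𝔸)‖ ≤ 1) (D : 𝔸) (a : ℕ → ℝ) (Z : ℕ → 𝔸)
    (k : ℕ) (ha : ∀ i < k, 0 ≤ a i) :
    ‖stepProd D a Z k - exp ((∑ i ∈ Finset.range k, a i) • D)‖ ≤
      Real.exp (∑ i ∈ Finset.range k, (a i * ‖D‖ + ‖Z i‖)) *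
        ∑ i ∈ Finset.range k, (‖Z i‖ + a i ^ 2 * ‖D‖ ^ 2) := by
  induction k with
  | zero => simp [stepProd]
  | succ k ih =>
    have hak : 0 ≤ a k := ha k (by omega)
    specialize ih fun i hi => ha i (by omega)
    set s := ∑ i ∈ Finset.range k, a i with hs
    have hs0 : 0 ≤ s := Finset.sum_nonneg fun i hi => ha i (by simp at hi; omega)
    set X := ∑ i ∈ Finset.range k, (a i * ‖D‖ + ‖Z i‖) with hX
    set B := ∑ i ∈ Finset.range k, (‖Z i‖ + a i ^ 2 * ‖D‖ ^ 2) with hB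
    have hB0 : 0 ≤ B := Finset.sum_nonneg fun i _ => by positivity
    have hsX : s * ‖D‖ ≤ X := by
      rw [hs, hX, Finset.sum_mul]
      exact Finset.sum_le_sum fun i _ => by linarith [norm_nonneg (Z i)]
    have hE : ‖exp (s • D)‖ ≤ Real.exp X := by
      refine (norm_exp_le_exp_norm h1 _).trans (Real.exp_le_exp.2 ?_)
      rwa [norm_smul, Real.norm_of_nonneg hs0]
    have hexp : exp ((∑ i ∈ Finset.range (k + 1), a i) • D) = exp (a k • D) * exp (s • D) := by
      rw [Finset.sum_range_succ, add_comm, add_smul]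
      let := NormedAlgebra.restrictScalars ℚ ℝ 𝔸
      exact exp_add_of_commute (((Commute.refl D).smul_left _).smul_right _)
    have hT : ‖1 + a k • D + Z k‖ ≤ Real.exp (a k * ‖D‖ + ‖Z k‖) := by
      have h2 : ‖1 + a k • D + Z k‖ ≤ ‖(1 : 𝔸)‖ + ‖a k • D‖ + ‖Z k‖ := norm_add₃_le
      rw [norm_smul, Real.norm_of_nonneg hak] at h2
      linarith [Real.add_one_le_exp (a k * ‖D‖ + ‖Z k‖)]
    have hd : ‖1 + a k • D + Z k - exp (a k • D)‖ ≤
        (‖Z k‖ + a k ^ 2 * ‖D‖ ^ 2) * Real.exp (a k * ‖D‖ + ‖Z k‖) := by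
      have h2 := norm_exp_sub_one_sub_le (a k • D)
      rw [norm_smul, Real.norm_of_nonneg hak, mul_pow] at h2
      have h3 : ‖1 + a k • D + Z k - exp (a k • D)‖ ≤
          ‖Z k‖ + ‖exp (a k • D) - 1 - a k • D‖ := by
        have : 1 + a k • D + Z k - exp (a k • D) = Z k - (exp (a k • D) - 1 - a k • D) := by abel
        rw [this]
        exact norm_sub_le _ _
      have h4 : Real.exp (a k * ‖D‖) ≤ Real.exp (a k * ‖D‖ + ‖Z k‖) :=
        Real.exp_le_exp.2 (by linarith [norm_nonneg (Z k)])
      have h5 : 1 ≤ Real.exp (a k * ‖D‖ + ‖Z k‖) := Real.one_le_exp (by positivity)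
      have h6 := mul_le_mul_of_nonneg_left h4 (by positivity : 0 ≤ a k ^ 2 * ‖D‖ ^ 2)
      have h7 := mul_le_mul_of_nonneg_left h5 (norm_nonneg (Z k))
      linarith
    have hsplit : stepProd D a Z (k + 1) - exp ((∑ i ∈ Finset.range (k + 1), a i) • D) =
        (1 + a k • D + Z k) * (stepProd D a Z k - exp (s • D)) +
          (1 + a k • D + Z k - exp (a k • D)) * exp (s • D) := by
      rw [hexp, stepProd]; noncomm_ring
    rw [hsplit, Finset.sum_range_succ, Finset.sum_range_succ, ← hX, ← hB, Real.exp_add]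
    refine (norm_add_le _ _).trans ?_
    have h8 := (norm_mul_le (1 + a k • D + Z k) (stepProd D a Z k - exp (s • D))).trans
      (mul_le_mul hT ih (norm_nonneg _) (Real.exp_pos _).le)
    have h9 := (norm_mul_le (1 + a k • D + Z k - exp (a k • D)) (exp (s • D))).trans
      (mul_le_mul hd hE (norm_nonneg _) (by positivity))
    linarith

/-- A product of factors `1 + aᵢ D + Zᵢ` converges to the exponential of `(∑ aᵢ) D` if the `aᵢ`
are uniformly small and the `Zᵢ` are negligible. -/
theorem tendsto_stepProd {ι : Type*} {l : Filter ι} (h1 : ‖(1 : 𝔸)‖ ≤ 1) (D : 𝔸)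
    (a : ι → ℕ → ℝ) (Z : ι → ℕ → 𝔸) (k : ι → ℕ) {s : ℝ}
    (ha : ∀ᶠ j in l, ∀ i < k j, 0 ≤ a j i)
    (hs : Filter.Tendsto (fun j => ∑ i ∈ Finset.range (k j), a j i) l (nhds s))
    (hs2 : Filter.Tendsto (fun j => ∑ i ∈ Finset.range (k j), a j i ^ 2) l (nhds 0))
    (hZ : Filter.Tendsto (fun j => ∑ i ∈ Finset.range (k j), ‖Z j i‖) l (nhds 0)) :
    Filter.Tendsto (fun j => stepProd D (a j) (Z j) (k j)) l (nhds (exp (s • D))) := by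
  have hexp : Filter.Tendsto (fun j => exp ((∑ i ∈ Finset.range (k j), a j i) • D)) l
      (nhds (exp (s • D))) :=
    let := NormedAlgebra.restrictScalars ℚ ℝ 𝔸
    (hs.smul_const D).exp
  have hdiff : Filter.Tendsto (fun j => stepProd D (a j) (Z j) (k j) -
      exp ((∑ i ∈ Finset.range (k j), a j i) • D)) l (nhds 0) := by
    refine squeeze_zero_norm' (ha.mono fun j hj => norm_stepProd_sub_exp_le h1 D _ _ _ hj) ?_
    simp only [Finset.sum_add_distrib, ← Finset.sum_mul]
    have h2 := (Real.continuous_exp.tendsto _).comp ((hs.mul_const ‖D‖).add hZ)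
    have h3 := h2.mul (hZ.add (hs2.mul_const (‖D‖ ^ 2)))
    simpa using h3
  simpa using hdiff.add hexp

end EulerProduct

/-! ### Asymptotics of the two phases -/

section Asymptotics

open Filter Topology NormedSpace MeasureTheory

theorem tendsto_sqrt_natCast : Tendsto (fun n : ℕ => Real.sqrt n) atTop atTop :=
  Real.tendsto_sqrt_atTop.comp tendsto_natCast_atTop_atTop

theorem tendsto_floor_mul_sqrt_div {x : ℝ} (hx : 0 ≤ x) :
    Tendsto (fun n : ℕ => (⌊x * Real.sqrt n⌋₊ : ℝ) / Real.sqrt n) atTop (𝓝 x) :=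
  (tendsto_nat_floor_mul_div_atTop hx).comp tendsto_sqrt_natCast

theorem tendsto_mul_div_natCast {f g : ℕ → ℝ} {x y : ℝ}
    (hf : Tendsto (fun n : ℕ => f n / Real.sqrt n) atTop (𝓝 x))
    (hg : Tendsto (fun n : ℕ => g n / Real.sqrt n) atTop (𝓝 y)) :
    Tendsto (fun n : ℕ => f n * g n / n) atTop (𝓝 (x * y)) := by
  refine (hf.mul hg).congr fun n => ?_
  rw [div_mul_div_comm, Real.mul_self_sqrt (Nat.cast_nonneg n)]

theorem tendsto_const_div_sqrt (c : ℝ) :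
    Tendsto (fun n : ℕ => c / Real.sqrt n) atTop (𝓝 0) :=
  tendsto_sqrt_natCast.const_div_atTop c

theorem tendsto_div_natCast_of_sqrt {f : ℕ → ℝ} {x : ℝ}
    (hf : Tendsto (fun n : ℕ => f n / Real.sqrt n) atTop (𝓝 x)) :
    Tendsto (fun n : ℕ => f n / n) atTop (𝓝 0) := by
  simpa using tendsto_mul_div_natCast hf (tendsto_const_div_sqrt 1)

theorem sum_range_cast (k : ℕ) : ∑ i ∈ Finset.range k, (i : ℝ) = k * (k - 1) / 2 := by
  induction k with
  | zero => simp
  | succ k ih => rw [Finset.sum_range_succ, ih]; push_cast; ring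

theorem tendsto_sum_add_div {k r : ℕ → ℕ} {y x : ℝ}
    (hk : Tendsto (fun n : ℕ => (k n : ℝ) / Real.sqrt n) atTop (𝓝 y))
    (hr : Tendsto (fun n : ℕ => (r n : ℝ) / Real.sqrt n) atTop (𝓝 x)) :
    Tendsto (fun n : ℕ => ∑ i ∈ Finset.range (k n), ((r n : ℝ) + i) / n) atTop
      (𝓝 (y * x + y ^ 2 / 2)) := by
  have h := ((tendsto_mul_div_natCast hk hr).add
    ((tendsto_mul_div_natCast hk hk).div_const 2)).sub
    ((tendsto_div_natCast_of_sqrt hk).div_const 2)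
  have hlim : y * x + y * y / 2 - 0 / 2 = y * x + y ^ 2 / 2 := by ring
  rw [hlim] at h
  refine h.congr fun n => ?_
  rw [← Finset.sum_div, Finset.sum_add_distrib, sum_range_cast, Finset.sum_const,
    Finset.card_range, nsmul_eq_mul]
  ring

theorem tendsto_sum_add_div_sq {k r : ℕ → ℕ} {y x : ℝ}
    (hk : Tendsto (fun n : ℕ => (k n : ℝ) / Real.sqrt n) atTop (𝓝 y))
    (hr : Tendsto (fun n : ℕ => (r n : ℝ) / Real.sqrt n) atTop (𝓝 x)) :
    Tendsto (fun n : ℕ => ∑ i ∈ Finset.range (k n), (((r n : ℝ) + i) / n) ^ 2) atTop (𝓝 0) := by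
  have h0 := ((tendsto_div_natCast_of_sqrt hr).add (tendsto_div_natCast_of_sqrt hk)).mul
    (tendsto_sum_add_div hk hr)
  rw [add_zero, zero_mul] at h0
  refine squeeze_zero (fun n => by positivity) (fun n => ?_) h0
  rw [Finset.mul_sum]
  refine Finset.sum_le_sum fun i hi => ?_
  have hi' : (i : ℝ) ≤ k n := by exact_mod_cast (Finset.mem_range.1 hi).le
  rw [sq, ← add_div]
  gcongr

theorem stepProd_real_neg_one (a : ℕ → ℝ) (k : ℕ) :
    stepProd (-1 : ℝ) a (fun _ => 0) k = ∏ i ∈ Finset.range k, (1 - a i) := by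
  induction k with
  | zero => simp [stepProd]
  | succ k ih => rw [stepProd, ih, Finset.prod_range_succ]; simp; ring

/-- The scalar case `D = -1`, `Z = 0` of `tendsto_stepProd`. -/
theorem tendsto_prod_one_sub {k r : ℕ → ℕ} {y x : ℝ}
    (hk : Tendsto (fun n : ℕ => (k n : ℝ) / Real.sqrt n) atTop (𝓝 y))
    (hr : Tendsto (fun n : ℕ => (r n : ℝ) / Real.sqrt n) atTop (𝓝 x)) :
    Tendsto (fun n : ℕ => ∏ i ∈ Finset.range (k n), (1 - ((r n : ℝ) + i) / n)) atTop
      (𝓝 (Real.exp (-(y * x + y ^ 2 / 2)))) := by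
  have h := tendsto_stepProd (by simp) (-1 : ℝ) (fun n i => ((r n : ℝ) + i) / n)
    (fun _ _ => 0) k (Eventually.of_forall fun n i _ => by positivity)
    (tendsto_sum_add_div hk hr) (tendsto_sum_add_div_sq hk hr) (by simp)
  simpa [stepProd_real_neg_one, ← Real.exp_eq_exp_ℝ] using h

/-! ### Transition operators of the second phase -/

/-- The forward difference operator on functions of `{0, …, ℓ - 1}` extended by zero. -/
noncomputable def forwardDiff (ℓ : ℕ) : (Fin ℓ → ℝ) →L[ℝ] (Fin ℓ → ℝ) :=
  LinearMap.toContinuousLinearMap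
    { toFun := fun f i => (if h : (i : ℕ) + 1 < ℓ then f ⟨i + 1, h⟩ else 0) - f i
      map_add' := fun f g => by
        ext i
        by_cases h : (i : ℕ) + 1 < ℓ <;> simp [h] <;> ring
      map_smul' := fun c f => by
        ext i
        by_cases h : (i : ℕ) + 1 < ℓ <;> simp [h] <;> ring }

/-- The generator of the linear birth process, killed at `ℓ`. -/
noncomputable def birthGen (ℓ : ℕ) : (Fin ℓ → ℝ) →L[ℝ] (Fin ℓ → ℝ) :=
  LinearMap.toContinuousLinearMap
    { toFun := fun f i => ((i : ℕ) + 1 : ℝ) * forwardDiff ℓ f i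
      map_add' := fun f g => by ext i; simp [mul_add]
      map_smul' := fun c f => by ext i; simp; ring }

theorem birthGen_apply {ℓ : ℕ} (f : Fin ℓ → ℝ) (i : Fin ℓ) :
    birthGen ℓ f i = ((i : ℕ) + 1 : ℝ) * forwardDiff ℓ f i := rfl

/-- `leaderProb` as a function of the number of moved cards. -/
noncomputable def leaderVec (n ℓ N R : ℕ) : Fin ℓ → ℝ := fun i => leaderProb n ℓ N R i

theorem forwardDiff_leaderVec (n ℓ N R : ℕ) (i : Fin ℓ) :
    forwardDiff ℓ (leaderVec n ℓ N R) i = leaderProb n ℓ N R (i + 1) - leaderProb n ℓ N R i := by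
  change (if h : (i : ℕ) + 1 < ℓ then leaderProb n ℓ N R (i + 1) else 0) - _ = _
  split_ifs with h
  · rfl
  · rw [leaderProb_eq_zero N R (i + 1) (by omega)]; rfl

/-- The jump probability (V + 1 + (R-1))/n splits into a part constant in `V`, which gives the
forward difference, and the linear birth rate. -/
theorem leaderVec_succ {n ℓ : ℕ} (hn : n ≠ 0) (N R : ℕ) (h : ℓ + (R - 1) ≤ n) :
    leaderVec n ℓ (N + 1) R = (1 + (((R - 1 : ℕ) : ℝ) / n) • forwardDiff ℓ +
      (1 / (n : ℝ)) • birthGen ℓ) (leaderVec n ℓ N (R - 1)) := by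
  ext i
  have hi := i.isLt
  simp only [add_apply, smul_apply,
    Pi.add_apply, Pi.smul_apply, birthGen_apply, forwardDiff_leaderVec, smul_eq_mul,
    one_apply_eq_self]
  simp only [leaderVec]
  rw [leaderProb_succ hn _ _ _ (by omega)]
  ring

theorem leaderVec_zero_right {n ℓ : ℕ} (hn : n ≠ 0) (h : ℓ ≤ n) (N : ℕ) :
    leaderVec n ℓ N 0 = stepProd (birthGen ℓ) (fun _ => 1 / (n : ℝ)) (fun _ => 0) N 1 := by
  induction N with
  | zero =>
    ext i
    simp [leaderVec, stepProd, leaderProb, walkMean]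
  | succ N ih =>
    rw [leaderVec_succ hn N 0 (by omega), stepProd, mul_apply_eq_comp, ← ih]
    simp

theorem leaderVec_eq {n ℓ : ℕ} (hn : n ≠ 0) (N R : ℕ) (h : ℓ + R ≤ n) :
    leaderVec n ℓ (N + R) R = stepProd (forwardDiff ℓ) (fun i => (i : ℝ) / n)
      (fun _ => (1 / (n : ℝ)) • birthGen ℓ) R (leaderVec n ℓ N 0) := by
  induction R with
  | zero => simp [stepProd]
  | succ R ih =>
    rw [← add_assoc, leaderVec_succ hn _ _ (by omega), Nat.add_sub_cancel, ih (by omega)]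
    rfl

/-- The limit of `leaderProb` when the number of unmoved cards is of order `x √n`. -/
noncomputable def leaderLimit (ℓ : ℕ) [NeZero ℓ] (x : ℝ) : ℝ :=
  (exp ((x ^ 2 / 2) • forwardDiff ℓ) (exp (birthGen ℓ) 1)) 0

/-- During the first `r n` steps the coefficients i/n of the forward difference add up to x²/2,
while the birth terms total r/n → 0. The other N - r steps, of size 1/n each, make up unit time for
the birth process. -/
theorem tendsto_leaderProb {ℓ : ℕ} [NeZero ℓ] {N r : ℕ → ℕ} {x : ℝ}
    (hN : Tendsto (fun n : ℕ => (N n : ℝ) / n) atTop (𝓝 1))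
    (hr : Tendsto (fun n : ℕ => (r n : ℝ) / Real.sqrt n) atTop (𝓝 x)) :
    Tendsto (fun n => leaderProb n ℓ (N n) (r n) 0) atTop (𝓝 (leaderLimit ℓ x)) := by
  have hr0 := tendsto_div_natCast_of_sqrt hr
  have hone : ‖(1 : (Fin ℓ → ℝ) →L[ℝ] (Fin ℓ → ℝ))‖ ≤ 1 := ContinuousLinearMap.norm_id_le
  have hzero : Tendsto (fun n : ℕ => ((0 : ℕ) : ℝ) / Real.sqrt n) atTop (𝓝 0) := by simp
  have ha : Tendsto (fun n : ℕ => stepProd (forwardDiff ℓ) (fun i => (i : ℝ) / n)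
      (fun _ => (1 / (n : ℝ)) • birthGen ℓ) (r n)) atTop
      (𝓝 (exp ((x ^ 2 / 2) • forwardDiff ℓ))) := by
    refine tendsto_stepProd hone _ (fun (n i : ℕ) => (i : ℝ) / n) _ r
      (Eventually.of_forall fun n i _ => by positivity) ?_ ?_ ?_
    · simpa using tendsto_sum_add_div hr hzero
    · simpa using tendsto_sum_add_div_sq hr hzero
    · have := hr0.mul_const ‖birthGen ℓ‖
      rw [zero_mul] at this
      refine this.congr fun n => ?_
      simp [norm_smul]
      ring
  have hNr : ∀ᶠ n : ℕ in atTop, ℓ + r n ≤ n ∧ r n ≤ N n ∧ n ≠ 0 := by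
    have h1 := (tendsto_const_nhds (x := (ℓ : ℝ))).div_atTop tendsto_natCast_atTop_atTop
    have h2 := (h1.add hr0).eventually_lt_const (show (0 : ℝ) + 0 < 1 by norm_num)
    have h3 := (hN.sub hr0).eventually_const_lt (show (0 : ℝ) < 1 - 0 by norm_num)
    filter_upwards [h2, h3, eventually_gt_atTop 0] with n h2 h3 hn
    have hn' : (0 : ℝ) < n := by exact_mod_cast hn
    rw [← add_div, div_lt_one hn'] at h2
    rw [← sub_div, div_pos_iff_of_pos_right hn', sub_pos] at h3
    exact ⟨by exact_mod_cast h2.le, by exact_mod_cast h3.le, hn.ne'⟩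
  have hNr1 : Tendsto (fun n => ((N n - r n : ℕ) : ℝ) / n) atTop (𝓝 1) := by
    have h := hN.sub hr0
    rw [sub_zero] at h
    refine h.congr' (hNr.mono fun n hn => ?_)
    beta_reduce
    rw [Nat.cast_sub hn.2.1, sub_div]
  have hb : Tendsto (fun n : ℕ => stepProd (birthGen ℓ) (fun _ => 1 / (n : ℝ)) (fun _ => 0)
      (N n - r n)) atTop (𝓝 (exp (birthGen ℓ))) := by
    have := tendsto_stepProd hone (birthGen ℓ) (fun (n _ : ℕ) => 1 / (n : ℝ)) (fun _ _ => 0)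
      (fun n => N n - r n) (s := 1) (l := atTop)
      (Eventually.of_forall fun n i _ => by positivity) ?_ ?_ (by simp)
    · simpa using this
    · refine hNr1.congr fun n => ?_
      simp [div_eq_mul_inv]
    · have h := hNr1.mul (tendsto_one_div_atTop_nhds_zero_nat (𝕜 := ℝ))
      rw [mul_zero] at h
      refine h.congr fun n => ?_
      simp
      ring
  have happ : ∀ {A : ℕ → (Fin ℓ → ℝ) →L[ℝ] (Fin ℓ → ℝ)} {B : (Fin ℓ → ℝ) →L[ℝ] (Fin ℓ → ℝ)}
      {f : ℕ → Fin ℓ → ℝ} {g : Fin ℓ → ℝ}, Tendsto A atTop (𝓝 B) → Tendsto f atTop (𝓝 g) →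
      Tendsto (fun n => A n (f n)) atTop (𝓝 (B g)) := fun {A B f g} hA hf =>
    (isBoundedBilinearMap_apply.continuous.tendsto (B, g)).comp (hA.prodMk_nhds hf)
  have hfin : Tendsto (fun n : ℕ => (stepProd (forwardDiff ℓ) (fun i => (i : ℝ) / n)
      (fun _ => (1 / (n : ℝ)) • birthGen ℓ) (r n)) ((stepProd (birthGen ℓ)
      (fun _ => 1 / (n : ℝ)) (fun _ => 0) (N n - r n)) 1)) atTop
      (𝓝 (exp ((x ^ 2 / 2) • forwardDiff ℓ) (exp (birthGen ℓ) 1))) :=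
    happ ha (happ hb tendsto_const_nhds)
  refine ((tendsto_pi_nhds.1 hfin) 0).congr' (hNr.mono fun n hn => ?_)
  rw [← leaderVec_zero_right hn.2.2 (by omega), ← leaderVec_eq hn.2.2 _ _ hn.1,
    Nat.sub_add_cancel hn.2.1]
  simp [leaderVec]

/-! ### Sums as integrals -/

theorem integral_Ioi_comp_floor (g : ℕ → ℝ) (K : ℕ) (hg : ∀ r, K ≤ r → g r = 0) {b : ℝ}
    (hb : 0 < b) :
    ∫ x in Set.Ioi (0 : ℝ), g ⌊b * x⌋₊ = b⁻¹ * ∑ r ∈ Finset.range K, g r := by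
  rw [integral_comp_mul_left_Ioi (fun y => g ⌊y⌋₊) 0 hb, mul_zero, smul_eq_mul,
    ← integral_Ici_eq_integral_Ioi]
  congr 1
  have h : ∀ x ∈ Set.Ici (0 : ℝ), g ⌊x⌋₊ =
      ∑ r ∈ Finset.range K, (Set.Ico (r : ℝ) (r + 1)).indicator (fun _ => g r) x := by
    intro x hx
    have hmem : ∀ r : ℕ, x ∈ Set.Ico (r : ℝ) (r + 1) ↔ ⌊x⌋₊ = r := fun r =>
      (Nat.floor_eq_iff hx).symm
    simp only [Set.indicator_apply, hmem]
    rw [Finset.sum_ite_eq]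
    split_ifs with h
    · rfl
    · exact hg _ (by simpa using h)
  have hsub : ∀ r : ℕ, Set.Ici (0 : ℝ) ∩ Set.Ico (r : ℝ) (r + 1) = Set.Ico (r : ℝ) (r + 1) :=
    fun r => Set.inter_eq_right.2 fun x hx => (Nat.cast_nonneg r).trans hx.1
  rw [setIntegral_congr_fun measurableSet_Ici h, integral_finsetSum]
  · refine Finset.sum_congr rfl fun r _ => ?_
    rw [setIntegral_indicator measurableSet_Ico, hsub]
    simp
  · intro r _
    refine (integrable_indicator_iff measurableSet_Ico).2 ?_
    refine integrableOn_const ?_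
    rw [Measure.restrict_apply measurableSet_Ico]
    refine ((measure_mono Set.inter_subset_left).trans_lt ?_).ne
    simp

/-- The sum is the integral of a step function of x = r/√n, to which dominated convergence applies.
-/
theorem tendsto_sum_leaderProb {ℓ : ℕ} [NeZero ℓ] {M : ℝ} (hM : 0 < M) :
    Tendsto (fun n : ℕ => ∑ r ∈ Finset.range (n - ⌊M * Real.sqrt n⌋₊),
      leaderProb n ℓ (n - ⌊M * Real.sqrt n⌋₊) (r + 1) 0 *
        frontMass n ⌊M * Real.sqrt n⌋₊ (r + 1)) atTop
      (𝓝 (∫ x in Set.Ioi (0 : ℝ),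
        leaderLimit ℓ x * (M * Real.exp (-(M * x + M ^ 2 / 2))))) := by
  set m : ℕ → ℕ := fun n => ⌊M * Real.sqrt n⌋₊ with hm
  have hmM : Tendsto (fun n : ℕ => (m n : ℝ) / Real.sqrt n) atTop (𝓝 M) :=
    tendsto_floor_mul_sqrt_div hM.le
  have hm1 : ∀ᶠ n in atTop, 1 ≤ m n ∧ 1 ≤ n := by
    have h := (tendsto_sqrt_natCast.const_mul_atTop hM).eventually_ge_atTop 1
    filter_upwards [h, eventually_ge_atTop 1] with n hn hn1
    exact ⟨(Nat.one_le_floor_iff _).2 hn, hn1⟩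
  have hm' : Tendsto (fun n : ℕ => ((m n - 1 : ℕ) : ℝ) / Real.sqrt n) atTop (𝓝 M) := by
    have h := hmM.sub (tendsto_const_div_sqrt 1)
    rw [sub_zero] at h
    refine h.congr' (hm1.mono fun n hn => ?_)
    beta_reduce
    rw [Nat.cast_sub hn.1, sub_div, Nat.cast_one]
  set g : ℕ → ℕ → ℝ := fun n r => if r < n - m n then
    leaderProb n ℓ (n - m n) (r + 1) 0 * frontMass n (m n) (r + 1) else 0 with hg
  have hsum : ∀ᶠ n : ℕ in atTop, ∫ x in Set.Ioi (0 : ℝ),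
      Real.sqrt n * g n ⌊Real.sqrt n * x⌋₊ =
      ∑ r ∈ Finset.range (n - m n), leaderProb n ℓ (n - m n) (r + 1) 0 *
        frontMass n (m n) (r + 1) := by
    filter_upwards [hm1] with n hn
    have hs : 0 < Real.sqrt n := Real.sqrt_pos.2 (by exact_mod_cast hn.2)
    rw [integral_const_mul, integral_Ioi_comp_floor (g n) (n - m n)
      (fun r hr => if_neg (by omega)) hs, mul_inv_cancel_left₀ hs.ne']
    exact Finset.sum_congr rfl fun r hr => if_pos (Finset.mem_range.1 hr)
  refine Tendsto.congr' hsum ?_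
  refine tendsto_integral_filter_of_dominated_convergence
    -- Half of `M` leaves room for the missing factor of the product: eventually `(m n - 1)/√n ≥
    -- M/2`.
    (fun x => M * Real.exp (-(M / 2) * x)) ?_ ?_ ?_ ?_
  · refine Eventually.of_forall fun n => Measurable.aestronglyMeasurable ?_
    exact ((measurable_from_nat (f := g n)).comp
      (Nat.measurable_floor.comp (measurable_const_mul _))).const_mul _
  · have hhalf := hm'.eventually_const_le (show M / 2 < M by linarith)
    filter_upwards [hm1, hhalf] with n hn hhalf
    refine (ae_restrict_iff' measurableSet_Ioi).2 (Eventually.of_forall fun x hx => ?_)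
    have hx : 0 < x := hx
    have hn0 : (0 : ℝ) < n := by exact_mod_cast hn.2
    have hs : 0 < Real.sqrt n := Real.sqrt_pos.2 hn0
    have hss : Real.sqrt n * Real.sqrt n = n := Real.mul_self_sqrt hn0.le
    simp only [hg]
    set r := ⌊Real.sqrt n * x⌋₊ with hr
    split_ifs with hrn
    swap
    · simp only [mul_zero, norm_zero]; positivity
    have hrx : Real.sqrt n * x ≤ r + 1 := (Nat.lt_floor_add_one _).le
    have hfac : ∀ i ∈ Finset.range (m n - 1),
        0 ≤ 1 - (((r + 1 : ℕ) : ℝ) + 1 + i) / n ∧ 1 - (((r + 1 : ℕ) : ℝ) + 1 + i) / n ≤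
          Real.exp (-((r + 1) / n)) := by
      intro i hi
      rw [Finset.mem_range] at hi
      constructor
      · rw [sub_nonneg, div_le_one hn0]
        exact_mod_cast (by omega : r + 1 + 1 + i ≤ n)
      · refine le_trans ?_ (Real.one_sub_le_exp_neg _)
        push_cast
        have : (0 : ℝ) ≤ i := i.cast_nonneg
        exact sub_le_sub_left (div_le_div_of_nonneg_right (by linarith) hn0.le) 1
    have hprod0 := Finset.prod_nonneg fun i hi => (hfac i hi).1
    have hprod1 := Finset.prod_le_prod (fun i hi => (hfac i hi).1) fun i hi => (hfac i hi).2
    rw [Finset.prod_const, Finset.card_range, ← Real.exp_nat_mul] at hprod1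
    have hexp : ((m n - 1 : ℕ) : ℝ) * -((r + 1) / n) ≤ -(M / 2) * x := by
      have h1 : M / 2 * (Real.sqrt n * x) ≤ ((m n - 1 : ℕ) : ℝ) / Real.sqrt n * (r + 1) :=
        mul_le_mul hhalf hrx (by positivity) (by positivity)
      have h2 : ((m n - 1 : ℕ) : ℝ) * -((r + 1) / n) =
          -(((m n - 1 : ℕ) : ℝ) / Real.sqrt n * (r + 1)) / Real.sqrt n := by
        rw [div_mul_eq_mul_div, neg_div, div_div, hss]; ring
      rw [h2, div_le_iff₀ hs]
      linarith
    have hmle : Real.sqrt n * (m n / n) ≤ M := by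
      have h1 : (m n : ℝ) ≤ M * Real.sqrt n := Nat.floor_le (by positivity)
      have h2 : Real.sqrt n * (m n / n) = m n / Real.sqrt n := by
        nth_rewrite 2 [← hss]; field_simp
      rw [h2, div_le_iff₀ hs]; exact h1
    have hl0 := leaderProb_nonneg n ℓ (n - m n) (r + 1) 0
    have hl1 := leaderProb_le_one (by omega : n ≠ 0) ℓ (n - m n) (r + 1) 0
    simp only [frontMass]
    rw [Real.norm_of_nonneg (by positivity)]
    calc Real.sqrt n * (leaderProb n ℓ (n - m n) (r + 1) 0 * (m n / n *
          ∏ i ∈ Finset.range (m n - 1), (1 - (((r + 1 : ℕ) : ℝ) + 1 + i) / n)))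
        = leaderProb n ℓ (n - m n) (r + 1) 0 * (Real.sqrt n * (m n / n) *
          ∏ i ∈ Finset.range (m n - 1), (1 - (((r + 1 : ℕ) : ℝ) + 1 + i) / n)) := by ring
      _ ≤ 1 * (M * Real.exp (-(M / 2) * x)) := by
          refine mul_le_mul hl1 (mul_le_mul hmle (hprod1.trans (Real.exp_le_exp.2 hexp)) hprod0
            hM.le) (by positivity) zero_le_one
      _ = _ := one_mul _
  · exact (exp_neg_integrableOn_Ioi 0 (by positivity : 0 < M / 2)).const_mul M
  · refine (ae_restrict_iff' measurableSet_Ioi).2 (Eventually.of_forall fun x hx => ?_)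
    have hx : 0 < x := hx
    set r : ℕ → ℕ := fun n => ⌊Real.sqrt n * x⌋₊ with hr
    have hrx : Tendsto (fun n : ℕ => (r n : ℝ) / Real.sqrt n) atTop (𝓝 x) := by
      simpa only [hr, mul_comm] using tendsto_floor_mul_sqrt_div hx.le
    have hadd : ∀ c : ℕ, Tendsto (fun n : ℕ => ((r n + c : ℕ) : ℝ) / Real.sqrt n) atTop (𝓝 x) := by
      intro c
      have := hrx.add (tendsto_const_div_sqrt c)
      simpa only [add_zero, ← add_div, ← Nat.cast_add] using this
    have hlt : ∀ᶠ n : ℕ in atTop, r n < n - m n := by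
      have h := ((tendsto_div_natCast_of_sqrt hrx).add
        (tendsto_div_natCast_of_sqrt hmM)).eventually_lt_const (show (0 : ℝ) + 0 < 1 by norm_num)
      filter_upwards [h, hm1] with n h hn
      rw [← add_div, div_lt_one (by exact_mod_cast hn.2)] at h
      have : r n + m n < n := by exact_mod_cast h
      omega
    have hN : Tendsto (fun n => ((n - m n : ℕ) : ℝ) / n) atTop (𝓝 1) := by
      have h := (tendsto_const_nhds (x := (1 : ℝ))).sub (tendsto_div_natCast_of_sqrt hmM)
      rw [sub_zero] at h
      refine h.congr' ?_
      filter_upwards [hlt, hm1] with n h hn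
      have hn0 : (n : ℝ) ≠ 0 := by exact_mod_cast (by omega : n ≠ 0)
      rw [Nat.cast_sub (by omega)]
      field_simp
    have h1 := tendsto_leaderProb (ℓ := ℓ) hN (hadd 1)
    have h2 := tendsto_prod_one_sub hm' (hadd 2)
    refine (h1.mul (hmM.mul h2)).congr' ?_
    filter_upwards [hlt, hm1] with n h hn
    have hn0 : (0 : ℝ) < n := by exact_mod_cast hn.2
    have hs : 0 < Real.sqrt n := Real.sqrt_pos.2 hn0
    have hss : Real.sqrt n * Real.sqrt n = n := Real.mul_self_sqrt hn0.le
    have h3 : ∀ i : ℕ, ((r n + 1 : ℕ) : ℝ) + 1 + i = ((r n + 2 : ℕ) : ℝ) + i := fun i => by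
      push_cast; ring
    have h4 : (m n : ℝ) / Real.sqrt n = Real.sqrt n * (m n / n) := by
      nth_rewrite 3 [← hss]; field_simp
    simp only [hg, frontMass]
    rw [if_pos h, h4]
    simp only [show ⌊Real.sqrt n * x⌋₊ = r n from rfl, h3]
    ring

/-! ### The probability of a small card in front -/

theorem smallCardInFront_eq {n : ℕ} {M L : ℝ} (hM : 0 ≤ M) (hL : 0 ≤ L) :
    smallCardInFront n M L =
      {σ | ∃ j : Fin n, (j : ℕ) < ⌊L⌋₊ ∧ (σ j : ℕ) < ⌊M * Real.sqrt n⌋₊} := by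
  have key : ∀ (k : ℕ) (x : ℝ), 0 ≤ x → ((k : ℝ) + 1 ≤ x ↔ k < ⌊x⌋₊) := fun k x hx => by
    rw [← Nat.succ_le_iff, Nat.le_floor_iff hx, Nat.cast_succ]
  ext σ
  simp only [smallCardInFront, Set.mem_ofPred_eq, key _ L hL,
    key _ _ (mul_nonneg hM (Real.sqrt_nonneg n))]

theorem eventually_floor_mul_sqrt {M : ℝ} (hM : 0 < M) :
    ∀ᶠ n : ℕ in atTop, 1 ≤ ⌊M * Real.sqrt n⌋₊ ∧ ⌊M * Real.sqrt n⌋₊ ≤ n ∧ 1 ≤ n := by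
  have h := (tendsto_sqrt_natCast.const_mul_atTop hM).eventually_ge_atTop 1
  have h2 := (tendsto_div_natCast_of_sqrt (tendsto_floor_mul_sqrt_div hM.le)).eventually_lt_const
    one_pos
  filter_upwards [h, h2, eventually_ge_atTop 1] with n hn h2 hn1
  rw [div_lt_one (by exact_mod_cast hn1)] at h2
  exact ⟨(Nat.one_le_floor_iff _).2 hn, by exact_mod_cast h2.le, hn1⟩

theorem tendsto_frontTail_one {M : ℝ} (hM : 0 < M) :
    Tendsto (fun n : ℕ => frontTail n ⌊M * Real.sqrt n⌋₊ 1) atTop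
      (𝓝 (Real.exp (-(M ^ 2 / 2)))) := by
  have h := tendsto_prod_one_sub (tendsto_floor_mul_sqrt_div hM.le) (r := fun _ => 1) (x := 0)
    (by simpa using tendsto_const_div_sqrt 1)
  simpa [frontTail] using h

theorem exists_tendsto_eventProb {M : ℝ} (hM : 0 < M) {L : ℝ} (hL : 0 ≤ L) :
    ∃ q : ℝ, Tendsto (fun n : ℕ => eventProb (shuffleLaw n 1) (smallCardInFront n M L)) atTop
      (𝓝 q) := by
  simp only [smallCardInFront_eq hM.le hL]
  rcases Nat.eq_zero_or_pos ⌊L⌋₊ with h0 | hpos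
  · refine ⟨0, ?_⟩
    simp [h0, eventProb]
  · have : NeZero ⌊L⌋₊ := ⟨hpos.ne'⟩
    have hN : Tendsto (fun n : ℕ => ((n - ⌊M * Real.sqrt n⌋₊ : ℕ) : ℝ) / n) atTop (𝓝 1) := by
      have h := (tendsto_const_nhds (x := (1 : ℝ))).sub
        (tendsto_div_natCast_of_sqrt (tendsto_floor_mul_sqrt_div hM.le))
      rw [sub_zero] at h
      refine h.congr' ?_
      filter_upwards [eventually_floor_mul_sqrt hM] with n hn
      have hn0 : (n : ℝ) ≠ 0 := by exact_mod_cast (by omega : n ≠ 0)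
      rw [Nat.cast_sub hn.2.1]
      field_simp
    -- The atom at `R = 0` contributes through the case `x = 0`.
    have h1 := tendsto_leaderProb (ℓ := ⌊L⌋₊) hN (r := fun _ => 0) (x := 0) (by simp)
    have h2 := (h1.mul ((tendsto_frontTail_one hM).const_sub 1)).add
      (tendsto_sum_leaderProb (ℓ := ⌊L⌋₊) hM)
    refine ⟨_, h2.congr' ?_⟩
    filter_upwards [eventually_floor_mul_sqrt hM] with n hn
    rw [eventProb_shuffleLaw_eq hn.1 hn.2.1]

theorem frontTail_one_mem_Icc {n m : ℕ} (hmn : m ≤ n) : frontTail n m 1 ∈ Set.Icc (0 : ℝ) 1 := by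
  have h : ∀ i ∈ Finset.range m, (0 : ℝ) ≤ 1 - (((1 : ℕ) : ℝ) + i) / n ∧
      1 - (((1 : ℕ) : ℝ) + i) / n ≤ 1 := by
    intro i hi
    rw [Finset.mem_range] at hi
    have hn0 : (0 : ℝ) < n := by exact_mod_cast (by omega : 0 < n)
    constructor
    · rw [sub_nonneg, div_le_one hn0]
      exact_mod_cast (by omega : 1 + i ≤ n)
    · rw [sub_le_self_iff]; positivity
  exact ⟨Finset.prod_nonneg fun i hi => (h i hi).1,
    Finset.prod_le_one (fun i hi => (h i hi).1) fun i hi => (h i hi).2⟩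

theorem frontMass_nonneg {n m r : ℕ} (h : r + m ≤ n) : 0 ≤ frontMass n m r := by
  refine mul_nonneg (by positivity) (Finset.prod_nonneg fun i hi => ?_)
  rw [Finset.mem_range] at hi
  have hn0 : (0 : ℝ) < n := by exact_mod_cast (by omega : 0 < n)
  rw [sub_nonneg, div_le_one hn0]
  exact_mod_cast (by omega : r + 1 + i ≤ n)

/-- Only the atom `R = 0` is kept, where a small card is on top after the first phase; all other
terms are nonnegative. -/
theorem le_of_tendsto_eventProb {M L q : ℝ} (hM : 0 < M) (hL : 1 ≤ L)
    (hq : Tendsto (fun n : ℕ => eventProb (shuffleLaw n 1) (smallCardInFront n M L)) atTop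
      (𝓝 q)) :
    (1 - Real.exp 1 / ⌊L⌋₊) * (1 - Real.exp (-(M ^ 2 / 2))) ≤ q := by
  simp only [smallCardInFront_eq hM.le (zero_le_one.trans hL)] at hq
  have hℓ : 1 ≤ ⌊L⌋₊ := (Nat.one_le_floor_iff _).2 hL
  refine le_of_tendsto_of_tendsto (((tendsto_frontTail_one hM).const_sub 1).const_mul _) hq ?_
  filter_upwards [eventually_floor_mul_sqrt hM, eventually_ge_atTop ⌊L⌋₊] with n hn hnL
  have hn0 : (0 : ℝ) < n := by exact_mod_cast (by omega : 0 < n)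
  rw [eventProb_shuffleLaw_eq hn.1 hn.2.1]
  set m := ⌊M * Real.sqrt n⌋₊
  have hsum : 0 ≤ ∑ r ∈ Finset.range (n - m),
      leaderProb n ⌊L⌋₊ (n - m) (r + 1) 0 * frontMass n m (r + 1) := by
    refine Finset.sum_nonneg fun r hr => mul_nonneg (leaderProb_nonneg _ _ _ _ _) ?_
    rw [Finset.mem_range] at hr
    exact frontMass_nonneg (by omega)
  have hpow : (1 + 1 / (n : ℝ)) ^ (n - m) ≤ Real.exp 1 := by
    calc (1 + 1 / (n : ℝ)) ^ (n - m) ≤ (1 + 1 / (n : ℝ)) ^ n :=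
          pow_le_pow_right₀ (by have : 0 < 1 / (n : ℝ) := by positivity
                                linarith) (Nat.sub_le _ _)
      _ ≤ Real.exp (1 / n) ^ n := by
          gcongr
          linarith [Real.add_one_le_exp (1 / (n : ℝ))]
      _ = Real.exp 1 := by rw [← Real.exp_nat_mul]; congr 1; field_simp
  have hlow := leaderProb_lower_bound (by omega : n ≠ 0) hℓ hnL (n - m) 0
  have hle : 1 - Real.exp 1 / ⌊L⌋₊ ≤ leaderProb n ⌊L⌋₊ (n - m) 0 0 := by
    refine le_trans ?_ hlow
    simp only [Nat.cast_zero, zero_add, one_mul]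
    gcongr
  have h1 := (frontTail_one_mem_Icc hn.2.1).2
  have := mul_le_mul_of_nonneg_right hle (sub_nonneg.2 h1)
  linarith

/-! ### Elementary bounds for probabilities and total variation -/

theorem eventProb_nonneg {α : Type*} (μ : PMF α) (A : Set α) : 0 ≤ eventProb μ A :=
  ENNReal.toReal_nonneg

theorem eventProb_le_one {α : Type*} (μ : PMF α) (A : Set α) : eventProb μ A ≤ 1 := by
  rw [eventProb]
  refine ENNReal.toReal_le_of_le_ofReal zero_le_one ?_
  rw [ENNReal.ofReal_one]
  exact (μ.toOuterMeasure.mono (Set.subset_univ A)).trans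
    ((PMF.toOuterMeasure_apply_eq_one_iff μ _).2 (Set.subset_univ _)).le

theorem totalVariation_le_one {α : Type*} (μ ν : PMF α) : totalVariation μ ν ≤ 1 :=
  Real.iSup_le (fun A => by linarith [eventProb_le_one μ A, eventProb_nonneg ν A]) zero_le_one

theorem sub_le_totalVariation {α : Type*} (μ ν : PMF α) (A : Set α) :
    eventProb μ A - eventProb ν A ≤ totalVariation μ ν :=
  le_ciSup (f := fun A : Set α => eventProb μ A - eventProb ν A)
    ⟨1, by rintro _ ⟨A, rfl⟩; linarith [eventProb_le_one μ A, eventProb_nonneg ν A]⟩ A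

/-! ### The uniform law -/

/-- Composing with the transposition of `i` and `i'` matches the fibres over these two values, so
all `n` fibres have the same size. -/
theorem card_perm_apply_eq {n : ℕ} (i j : Fin n) :
    n * (Finset.univ.filter fun σ : Equiv.Perm (Fin n) => σ j = i).card =
      Fintype.card (Equiv.Perm (Fin n)) := by
  have h : ∀ i' : Fin n, (Finset.univ.filter fun σ : Equiv.Perm (Fin n) => σ j = i').card =
      (Finset.univ.filter fun σ : Equiv.Perm (Fin n) => σ j = i).card := by
    intro i'
    refine Finset.card_equiv (Equiv.mulLeft (Equiv.swap i i')) fun σ => ?_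
    have hs : (Equiv.mulLeft (Equiv.swap i i') σ) j = Equiv.swap i i' (σ j) := rfl
    rw [Finset.mem_filter, Finset.mem_filter, hs, Equiv.swap_apply_eq_iff, Equiv.swap_apply_left]
    simp
  have h2 := Finset.card_eq_sum_card_fiberwise
    (f := fun σ : Equiv.Perm (Fin n) => σ j) (s := Finset.univ) (t := Finset.univ)
    (fun _ _ => Finset.mem_coe.2 (Finset.mem_univ _))
  rw [Finset.sum_congr rfl fun i' _ => h i', Finset.sum_const, Finset.card_univ,
    Finset.card_univ, Fintype.card_fin, smul_eq_mul] at h2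
  exact h2.symm

/-- A union bound over at most `ℓ * m` pairs of a position and a card, each of probability `1/n`. -/
theorem eventProb_uniformLaw_le {n : ℕ} (hn : n ≠ 0) (m ℓ : ℕ) :
    eventProb (uniformLaw n) {σ | ∃ j : Fin n, (j : ℕ) < ℓ ∧ (σ j : ℕ) < m} ≤ ℓ * m / n := by
  classical
  have hn0 : (0 : ℝ) < n := by exact_mod_cast Nat.pos_of_ne_zero hn
  set P := Fintype.card (Equiv.Perm (Fin n)) with hP
  have hP0 : (0 : ℝ) < P := by exact_mod_cast Fintype.card_pos
  set F := Finset.univ.filter fun σ : Equiv.Perm (Fin n) =>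
    ∃ j : Fin n, (j : ℕ) < ℓ ∧ (σ j : ℕ) < m with hF
  have hprob : eventProb (uniformLaw n) {σ | ∃ j : Fin n, (j : ℕ) < ℓ ∧ (σ j : ℕ) < m} =
      F.card / P := by
    rw [eventProb, uniformLaw, PMF.toOuterMeasure_uniformOfFintype_apply, ENNReal.toReal_div,
      ENNReal.toReal_natCast, ENNReal.toReal_natCast, ← hP, hF, ← Fintype.card_subtype]
    rfl
  have hsmall : ∀ k, ((Finset.univ : Finset (Fin n)).filter fun j : Fin n => (j : ℕ) < k).card ≤ k := by
    intro k
    calc _ = (((Finset.univ : Finset (Fin n)).filter fun j : Fin n => (j : ℕ) < k).map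
          Fin.valEmbedding).card := (Finset.card_map _).symm
      _ ≤ (Finset.range k).card := Finset.card_le_card fun x hx => by
          simp only [Finset.mem_map, Finset.mem_filter] at hx
          obtain ⟨j, hj, rfl⟩ := hx
          exact Finset.mem_range.2 hj.2
      _ = k := Finset.card_range k
  set J := (Finset.univ : Finset (Fin n)).filter fun j : Fin n => (j : ℕ) < ℓ
  set I := (Finset.univ : Finset (Fin n)).filter fun i : Fin n => (i : ℕ) < m
  have hsub : F ⊆ (J ×ˢ I).biUnion fun p => Finset.univ.filter fun σ => σ p.1 = p.2 := by
    intro σ hσ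
    obtain ⟨j, hj, hi⟩ := (Finset.mem_filter.1 hσ).2
    refine Finset.mem_biUnion.2 ⟨(j, σ j), ?_, by simp⟩
    simp [J, I, hj, hi]
  have hcard : n * F.card ≤ ℓ * m * P := by
    calc n * F.card ≤ n * ∑ p ∈ J ×ˢ I, (Finset.univ.filter fun σ : Equiv.Perm (Fin n) =>
          σ p.1 = p.2).card :=
          Nat.mul_le_mul_left _ ((Finset.card_le_card hsub).trans Finset.card_biUnion_le)
      _ = ∑ p ∈ J ×ˢ I, P := by
          rw [Finset.mul_sum]
          exact Finset.sum_congr rfl fun p _ => card_perm_apply_eq p.2 p.1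
      _ = J.card * I.card * P := by simp [Finset.card_product]
      _ ≤ ℓ * m * P := by gcongr <;> exact hsmall _
  rw [hprob, div_le_div_iff₀ hP0 hn0]
  have : (n : ℝ) * F.card ≤ ℓ * m * P := by exact_mod_cast hcard
  linarith

theorem tendsto_eventProb_uniformLaw {M L : ℝ} (hM : 0 < M) (hL : 0 ≤ L) :
    Tendsto (fun n : ℕ => eventProb (uniformLaw n) (smallCardInFront n M L)) atTop (𝓝 0) := by
  have h := (tendsto_div_natCast_of_sqrt (tendsto_floor_mul_sqrt_div hM.le)).const_mul
    (⌊L⌋₊ : ℝ)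
  rw [mul_zero] at h
  refine squeeze_zero' (Eventually.of_forall fun n => eventProb_nonneg _ _) ?_ h
  filter_upwards [eventually_ge_atTop 1] with n hn
  rw [smallCardInFront_eq hM.le hL, ← mul_div_assoc]
  exact eventProb_uniformLaw_le (by omega) _ _

/-! ### The limits in M and in total variation -/

theorem exists_limit_smallCardInFront {C : ℝ} (hC : 1 ≤ C) :
    ∃ q : ℝ → ℝ,
      (∀ M : ℝ, 0 < M →
        Tendsto (fun n : ℕ => eventProb (shuffleLaw n 1) (smallCardInFront n M (C * M ^ 2)))
          atTop (𝓝 (q M))) ∧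
      Tendsto q atTop (𝓝 1) := by
  have hex : ∀ M : ℝ, ∃ q : ℝ, 0 < M → Tendsto (fun n : ℕ => eventProb (shuffleLaw n 1)
      (smallCardInFront n M (C * M ^ 2))) atTop (𝓝 q) := by
    intro M
    by_cases hM : 0 < M
    · obtain ⟨q, hq⟩ := exists_tendsto_eventProb hM (by positivity : 0 ≤ C * M ^ 2)
      exact ⟨q, fun _ => hq⟩
    -- A default value for `M ≤ 0`, irrelevant to the limit at infinity.
    · exact ⟨0, fun h => absurd h hM⟩
  choose q hq using hex
  refine ⟨q, hq, ?_⟩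
  have hsq : Tendsto (fun M : ℝ => M ^ 2) atTop atTop := tendsto_pow_atTop two_ne_zero
  have hCM : Tendsto (fun M : ℝ => C * M ^ 2) atTop atTop :=
    hsq.const_mul_atTop (by linarith)
  have hfl : Tendsto (fun M : ℝ => (⌊C * M ^ 2⌋₊ : ℝ)) atTop atTop :=
    tendsto_natCast_atTop_atTop.comp (tendsto_nat_floor_atTop.comp hCM)
  have hexp : Tendsto (fun M : ℝ => Real.exp (-(M ^ 2 / 2))) atTop (𝓝 0) :=
    Real.tendsto_exp_neg_atTop_nhds_zero.comp (hsq.atTop_div_const two_pos)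
  have hlow := ((hfl.const_div_atTop (Real.exp 1)).const_sub 1).mul (hexp.const_sub 1)
  rw [sub_zero, mul_one] at hlow
  refine tendsto_of_tendsto_of_tendsto_of_le_of_le' hlow tendsto_const_nhds ?_ ?_
  · filter_upwards [eventually_gt_atTop 0, hCM.eventually_ge_atTop 1] with M hM h1
    exact le_of_tendsto_eventProb hM h1 (hq M hM)
  · filter_upwards [eventually_gt_atTop 0] with M hM
    exact le_of_tendsto (hq M hM) (Eventually.of_forall fun n => eventProb_le_one _ _)

/-- For each a < 1 a single fixed `M` with `q M > a` suffices: as n grows, the uniform probability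
of its event vanishes. -/
theorem tendsto_totalVariation_shuffleLaw :
    Tendsto (fun n : ℕ => totalVariation (shuffleLaw n 1) (uniformLaw n)) atTop (𝓝 1) := by
  obtain ⟨q, hq, hq1⟩ := exists_limit_smallCardInFront le_rfl
  refine tendsto_order.2 ⟨fun a ha => ?_, fun a ha => Eventually.of_forall fun n =>
    (totalVariation_le_one _ _).trans_lt ha⟩
  obtain ⟨M, hMq, hM⟩ := ((hq1.eventually_const_lt ha).and (eventually_gt_atTop 0)).exists
  have h := (hq M hM).sub (tendsto_eventProb_uniformLaw hM (by positivity : 0 ≤ 1 * M ^ 2))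
  rw [sub_zero] at h
  filter_upwards [h.eventually_const_lt hMq] with n hn
  exact hn.trans_le (sub_le_totalVariation _ _ _)

end Asymptotics

theorem theorem3 :
    (∃ C₀ : ℝ, 0 < C₀ ∧ ∀ C : ℝ, C₀ ≤ C →
      ∃ q : ℝ → ℝ,
        (∀ M : ℝ, 0 < M →
          Filter.Tendsto
            (fun n : ℕ => eventProb (shuffleLaw n 1) (smallCardInFront n M (C * M ^ 2)))
            Filter.atTop (nhds (q M))) ∧
        Filter.Tendsto q Filter.atTop (nhds 1)) ∧
    Filter.Tendsto (fun n : ℕ => totalVariation (shuffleLaw n 1) (uniformLaw n))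
      Filter.atTop (nhds 1) :=
  ⟨⟨1, one_pos, fun _ hC => exists_limit_smallCardInFront hC⟩, tendsto_totalVariation_shuffleLaw⟩
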